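/- Let $k\in\{3,4\}$. The probability that $k$ positive integers have a property $P$ means $\lim_{n\to\infty} n^{-k}\,\#\{(a_1,\dots,a_k)\in\{1,\dots,n\}^k : P\}$. For a (simple, labelled) graph $G$ on $\{1,\dots,k\}$, the integers $a_1,\dots,a_k$ are called $G$-wise relatively prime if $\gcd(a_i,a_j)=1$ for every edge $\{i,j\}$ of $G$, and $i_m(G)$ denotes the number of independent sets of cardinality $m$ in $G$. A graph is of type I if all its edges share a common vertex, and of type II otherwise. All products below run over all primes $p$ and converge, and all the probabilities below exist. (a) Three integers. For every graph $G$ on 3 vertices with $i$ edges, the probability that three positive integers are $G$-wise relatively prime is $A_{3,i}$, where $$A_{3,0}=1,\quad A_{3,1}=\prod_p\Big(1-\frac1{p^2}\Big),\quad A_{3,2}=\prod_p\Big(1-\frac1p\Big)\Big(1+\Big(1-\frac1p\Big)\frac1p\Big),\quad A_{3,3}=\prod_p\Big(1-\frac1p\Big)^2\Big(1+\frac2p\Big),$$ and the probability that three positive integers are pairwise not relatively prime is (Freiberg's value) $$A_{3,=0}=1-3A_{3,1}+3A_{3,2}-A_{3,3}.$$ (b) Graphs on 4 vertices. The numbers of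 labelled graphs on $\{1,2,3,4\}$ in each class, and the values of $(i_2(G),i_3(G),i_4(G))$ for every graph $G$ in the class, are: - 0 edges: 1 graph, $(6,4,1)$; - 1 edge: 6 graphs, $(5,2,0)$; - 2 edges, type I: 12 graphs, $(4,1,0)$; - 2 edges, type II: 3 graphs, $(4,0,0)$; - 3 edges, type I: 4 graphs, $(3,1,0)$; - 3 edges, type II: 16 graphs, $(3,0,0)$; - 4 edges: 15 graphs, $(2,0,0)$; - 5 edges: 6 graphs, $(1,0,0)$; - 6 edges: 1 graph, $(0,0,0)$. (c) Four integers. For every graph $G$ on 4 vertices with $i$ edges, the probability that four positive integers are $G$-wise relatively prime is $A_{4,i}$ if $i\notin\{2,3\}$; for $i\in\{2,3\}$ it is $A_{4,i,1}$ if $G$ is of type I and $A_{4,i,2}$ if $G$ is of type II. Here $$A_{4,0}=1,\quad A_{4,1}=\prod_p\Big(1-\frac1{p^2}\Big),\quad A_{4,2,1}=\prod_p\Big(1-\frac1p\Big)\Big(1+\Big(1-\frac1p\Big)\frac1p\Big),\quad A_{4,2,2}=\prod_p\Big(1-\frac1{p^2}\Big)^2,$$ $$A_{4,3,1}=\prod_p\Big(1-\frac1p\Big)\Big(1+\Big(1-\frac1p\Big)^2\frac1p\Big),\quad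 A_{4,3,2}=\prod_p\Big(1-\frac1p\Big)^2\Big(1+\frac2p\Big),\quad A_{4,4}=\prod_p\Big(1-\frac1p\Big)^2\Big(1+\frac2p-\frac1{p^2}\Big),$$ $$A_{4,5}=\prod_p\Big(1-\frac1p\Big)^2\Big(1+2\Big(1-\frac1p\Big)\frac1p\Big),\quad A_{4,6}=\prod_p\Big(1-\frac1p\Big)^3\Big(1+\frac3p\Big).$$ The probability that four positive integers are pairwise not relatively prime is $$A_{4,=0}=1-6A_{4,1}+12A_{4,2,1}+3A_{4,2,2}-4A_{4,3,1}-16A_{4,3,2}+15A_{4,4}-6A_{4,5}+A_{4,6}.$$ -/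

import Mathlib

open Filter Topology

/-- The `k` integers `a i` are `G`-wise relatively prime: `gcd (a i) (a j) = 1` for every edge
`{i, j}` of `G`. -/
def GWiseCoprime {k : ℕ} (G : SimpleGraph (Fin k)) (a : Fin k → ℕ) : Prop :=
  ∀ i j : Fin k, G.Adj i j → Nat.Coprime (a i) (a j)

/-- The `k` integers `a i` are pairwise not relatively prime. -/
def PairwiseNotCoprime {k : ℕ} (a : Fin k → ℕ) : Prop :=
  ∀ i j : Fin k, i ≠ j → ¬ Nat.Coprime (a i) (a j)

/-- The number of `k`-tuples of positive integers with all entries at most `n` satisfying `P`. -/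
noncomputable def tupleCount {k : ℕ} (P : (Fin k → ℕ) → Prop) (n : ℕ) : ℕ :=
  {a : Fin k → ℕ | (∀ i, 1 ≤ a i ∧ a i ≤ n) ∧ P a}.ncard

/-- The probability that `k` positive integers satisfy `P` exists and equals `x`: the proportion
of `k`-tuples in `{1, …, n}` satisfying `P` tends to `x` as `n → ∞`. -/
def HasProbability {k : ℕ} (P : (Fin k → ℕ) → Prop) (x : ℝ) : Prop :=
  Tendsto (fun n : ℕ => (tupleCount P n : ℝ) / (n : ℝ) ^ k) atTop (𝓝 x)

/-- The number of independent sets of cardinality `m` in `G`. -/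
noncomputable def indepCount {k : ℕ} (G : SimpleGraph (Fin k)) (m : ℕ) : ℕ :=
  {s : Finset (Fin k) | G.IsNIndepSet m s}.ncard

/-- The (labelled) graphs on `k` vertices with exactly `i` edges. -/
def graphsWithEdges (k i : ℕ) : Set (SimpleGraph (Fin k)) :=
  {G | G.edgeSet.ncard = i}

/-- Type I: the graphs with `i` edges, all of which share a common vertex. -/
def graphsTypeI (k i : ℕ) : Set (SimpleGraph (Fin k)) :=
  {G | G ∈ graphsWithEdges k i ∧ ∃ v : Fin k, ∀ e ∈ G.edgeSet, v ∈ e}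

/-- Type II: the graphs with `i` edges which have no vertex common to all of them. -/
def graphsTypeII (k i : ℕ) : Set (SimpleGraph (Fin k)) :=
  {G | G ∈ graphsWithEdges k i ∧ ¬ ∃ v : Fin k, ∀ e ∈ G.edgeSet, v ∈ e}

/-- A row of the table for four vertices: the class `C` consists of `N` graphs, each having
exactly `a`, `b`, `c` independent sets of cardinality `2`, `3`, `4` respectively. -/
def TableRow (C : Set (SimpleGraph (Fin 4))) (N a b c : ℕ) : Prop :=
  C.ncard = N ∧
    ∀ G ∈ C, indepCount G 2 = a ∧ indepCount G 3 = b ∧ indepCount G 4 = c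

/-- For every graph `G` of the class `C`, the probability that `k` positive integers are `G`-wise
relatively prime exists and equals `x`. -/
def HasGWiseProbability {k : ℕ} (C : Set (SimpleGraph (Fin k))) (x : ℝ) : Prop :=
  ∀ G ∈ C, HasProbability (GWiseCoprime G) x

/-- The product `∏ f(p)` over all primes `p` converges (unconditionally) to `x`. -/
def HasEulerProduct (f : ℝ → ℝ) (x : ℝ) : Prop :=
  HasProd (fun p : Nat.Primes => f ((p : ℕ) : ℝ)) x

/-! A tuple is `G`-wise coprime iff, for every prime `p`, the indices `i` with `p ∣ a i` form an
independent set. The events `p ∣ a i` have density `1/p` and are asymptotically independent in `i`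
and over finitely many primes, so the density at `p` is `∑ m, i_m(G) p^(-m) (1 - 1/p)^(k-m)`.

Independence is obtained by expansion: the local condition is a multilinear polynomial in
divisibility indicators, and products of these average to `∏ 1 / d i` (`hasMean_prod_multilinear`).
Tuples violating the condition only at primes outside a finite set `T` have proportion at most `k²
∑_{p ∉ T} 1/p²`, uniformly in `n`; hence the Euler product (`hasProbability_gWiseCoprime`).

The numbers `i_m(G)` come from enumerating edge sets. Pairwise non-coprimality is `∏ (1 -
1_{coprime})` over the edges of the complete graph; expanding gives a signed sum over all graphs. -/

/-! ### Mean values of products of divisibility indicators -/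

/-- The box `{1, …, n} ^ k`. -/
def tupleBox (k n : ℕ) : Finset (Fin k → ℕ) :=
  Fintype.piFinset fun _ => Finset.Ioc 0 n

/-- The averages of `F` over the boxes `{1, …, n} ^ k` tend to `x`. -/
def HasMean {k : ℕ} (F : (Fin k → ℕ) → ℝ) (x : ℝ) : Prop :=
  Tendsto (fun n : ℕ => (∑ a ∈ tupleBox k n, F a) / (n : ℝ) ^ k) atTop (𝓝 x)

/-- The indicator of divisibility by `d`, as a real number. -/
def dvdInd (d m : ℕ) : ℝ := if d ∣ m then 1 else 0

theorem mem_tupleBox {k n : ℕ} {a : Fin k → ℕ} :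
    a ∈ tupleBox k n ↔ ∀ i, 1 ≤ a i ∧ a i ≤ n := by
  simp [tupleBox, Nat.succ_le_iff, Nat.pos_iff_ne_zero]

theorem dvdInd_nonneg (d m : ℕ) : 0 ≤ dvdInd d m := by
  unfold dvdInd; split_ifs <;> norm_num

theorem hasMean_indicator_iff {k : ℕ} {P : (Fin k → ℕ) → Prop} {x : ℝ} :
    HasMean (Set.indicator {a | P a} 1) x ↔ HasProbability P x := by
  classical
  have h (n : ℕ) : (tupleCount P n : ℝ) =
      ∑ a ∈ tupleBox k n, Set.indicator {a | P a} (1 : (Fin k → ℕ) → ℝ) a := by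
    have hs : {a : Fin k → ℕ | (∀ i, 1 ≤ a i ∧ a i ≤ n) ∧ P a}
        = ((tupleBox k n).filter P : Finset (Fin k → ℕ)) := by
      ext a; simp [mem_tupleBox]
    rw [tupleCount, hs, Set.ncard_coe_finset, Finset.card_filter]
    push_cast
    exact Finset.sum_congr rfl fun a _ => by simp [Set.indicator_apply]
  simp only [HasMean, HasProbability, h]

theorem HasMean.const_mul {k : ℕ} {F : (Fin k → ℕ) → ℝ} {x : ℝ} (h : HasMean F x) (c : ℝ) :
    HasMean (fun a => c * F a) (c * x) := by
  refine (Tendsto.const_mul c h).congr fun n => ?_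
  rw [← Finset.mul_sum, mul_div_assoc]

theorem HasMean.sum {k : ℕ} {ι : Type*} {s : Finset ι} {F : ι → (Fin k → ℕ) → ℝ} {x : ι → ℝ}
    (h : ∀ i ∈ s, HasMean (F i) (x i)) :
    HasMean (fun a => ∑ i ∈ s, F i a) (∑ i ∈ s, x i) := by
  refine (tendsto_finsetSum s h).congr fun n => ?_
  rw [Finset.sum_comm, Finset.sum_div]

theorem sum_tupleBox_prod_dvdInd {k : ℕ} (d : Fin k → ℕ) (n : ℕ) :
    ∑ a ∈ tupleBox k n, ∏ i, dvdInd (d i) (a i) = ∏ i, ((n / d i : ℕ) : ℝ) := by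
  rw [tupleBox, ← Finset.prod_univ_sum (fun _ => Finset.Ioc 0 n) fun i m => dvdInd (d i) m]
  refine Finset.prod_congr rfl fun i _ => ?_
  rw [← Nat.Ioc_filter_dvd_card_eq_div, Finset.card_filter]
  push_cast
  rfl

theorem hasMean_prod_dvdInd {k : ℕ} (d : Fin k → ℕ) :
    HasMean (fun a => ∏ i, dvdInd (d i) (a i)) (∏ i, 1 / (d i : ℝ)) := by
  have h (m : ℕ) : Tendsto (fun n : ℕ => ((n / m : ℕ) : ℝ) / n) atTop (𝓝 (1 / m)) := by
    have := (tendsto_nat_floor_mul_div_atTop (R := ℝ) (a := 1 / m) (by positivity)).comp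
      tendsto_natCast_atTop_atTop
    refine this.congr fun n => ?_
    rw [Function.comp_apply, one_div_mul_eq_div, Nat.floor_div_eq_div]
  refine (tendsto_finsetProd Finset.univ fun i _ => h (d i)).congr fun n => ?_
  rw [sum_tupleBox_prod_dvdInd, Finset.prod_div_distrib]
  simp

/-- Rounding down in `n / p` only helps, so the bound holds for every `n` and not just in the limit;
the sieve tail needs this uniformity. -/
theorem sum_tupleBox_dvdInd_mul_dvdInd_le {k : ℕ} {i j : Fin k} (hij : i ≠ j) (p n : ℕ) :
    ∑ a ∈ tupleBox k n, dvdInd p (a i) * dvdInd p (a j) ≤ (n : ℝ) ^ k * (1 / (p : ℝ) ^ 2) := by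
  set d : Fin k → ℕ := fun l => if l ∈ ({i, j} : Finset (Fin k)) then p else 1 with hd
  have h1 (a : Fin k → ℕ) : dvdInd p (a i) * dvdInd p (a j) = ∏ l, dvdInd (d l) (a l) := by
    have (l : Fin k) : dvdInd (d l) (a l) =
        if l ∈ ({i, j} : Finset (Fin k)) then dvdInd p (a l) else 1 := by
      simp only [hd]; split_ifs <;> simp [dvdInd]
    simp only [this, Finset.prod_ite_mem, Finset.univ_inter, Finset.prod_pair hij]
  have h2 : ∏ l, (1 / (d l : ℝ)) = 1 / (p : ℝ) ^ 2 := by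
    have (l : Fin k) : 1 / (d l : ℝ) =
        if l ∈ ({i, j} : Finset (Fin k)) then 1 / (p : ℝ) else 1 := by
      simp only [hd]; split_ifs <;> simp
    simp only [this, Finset.prod_ite_mem, Finset.univ_inter, Finset.prod_pair hij]
    ring
  simp only [h1, sum_tupleBox_prod_dvdInd, ← h2]
  calc ∏ l, ((n / d l : ℕ) : ℝ) ≤ ∏ l, ((n : ℝ) * (1 / (d l : ℝ))) :=
        Finset.prod_le_prod (fun _ _ => by positivity) fun l _ => by
          rw [mul_one_div]; exact Nat.cast_div_le
    _ = _ := by rw [Finset.prod_mul_distrib]; simp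

/-- Mean value of a product of local factors: if `L` is a multilinear polynomial, the local
conditions at the primes of a finite set are independent. -/
theorem hasMean_prod_multilinear {k : ℕ} (c : Finset (Fin k) → ℝ) (T : Finset Nat.Primes) :
    ∀ d : Fin k → ℕ, (∀ p ∈ T, ∀ i, Nat.Coprime (d i) p) →
      HasMean (fun a => (∏ i, dvdInd (d i) (a i)) *
          ∏ p ∈ T, ∑ W, c W * ∏ i ∈ W, dvdInd p (a i))
        ((∏ i, 1 / (d i : ℝ)) * ∏ p ∈ T, ∑ W, c W * ∏ _i ∈ W, 1 / ((p : ℕ) : ℝ)) := by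
  classical
  induction T using Finset.induction_on with
  | empty => intro d _; simpa using hasMean_prod_dvdInd d
  | insert q T hq ih =>
    intro d hd
    -- Choosing the monomial `W` in the factor at `q` multiplies `d i` by `q` for `i ∈ W`. The
    -- result is again coprime to the remaining primes, which is why the induction runs over all
    -- `d`.
    set d' : Finset (Fin k) → Fin k → ℕ := fun W i => if i ∈ W then d i * q else d i with hd'
    have hcop (W : Finset (Fin k)) : ∀ p ∈ T, ∀ i, Nat.Coprime (d' W i) p := by
      intro p hp i
      have h1 := hd p (Finset.mem_insert_of_mem hp) i
      have h2 : Nat.Coprime q p := (Nat.coprime_primes q.2 p.2).2 fun h =>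
        hq (by rwa [Subtype.ext h])
      simp only [hd']
      split_ifs
      · exact Nat.Coprime.mul_left h1 h2
      · exact h1
    have key := HasMean.sum (s := Finset.univ) fun W _ => (ih (d' W) (hcop W)).const_mul (c W)
    convert key using 1
    · ext a
      rw [Finset.prod_insert hq, Finset.sum_mul, Finset.mul_sum]
      refine Finset.sum_congr rfl fun W _ => ?_
      have : ∏ i, dvdInd (d' W i) (a i) =
          (∏ i, dvdInd (d i) (a i)) * ∏ i ∈ W, dvdInd q (a i) := by
        rw [← Finset.univ_inter W, ← Finset.prod_ite_mem, ← Finset.prod_mul_distrib]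
        refine Finset.prod_congr rfl fun i _ => ?_
        simp only [hd', Finset.univ_inter]
        split_ifs
        · have h1 := hd q (Finset.mem_insert_self _ _) i
          have h2 : d i * q ∣ a i ↔ d i ∣ a i ∧ (q : ℕ) ∣ a i :=
            ⟨fun h => ⟨dvd_of_mul_right_dvd h, dvd_of_mul_left_dvd h⟩,
              fun h => h1.mul_dvd_of_dvd_of_dvd h.1 h.2⟩
          simp only [dvdInd, h2, ite_and]
          split_ifs <;> simp
        · simp
      rw [this]
      ring
    · rw [Finset.prod_insert hq, Finset.sum_mul, Finset.mul_sum]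
      refine Finset.sum_congr rfl fun W _ => ?_
      have : ∏ i, (1 / (d' W i : ℝ)) =
          (∏ i, 1 / (d i : ℝ)) * ∏ i ∈ W, 1 / ((q : ℕ) : ℝ) := by
        rw [← Finset.univ_inter W, ← Finset.prod_ite_mem, ← Finset.prod_mul_distrib]
        refine Finset.prod_congr rfl fun i _ => ?_
        simp only [hd', Finset.univ_inter]
        split_ifs
        · push_cast; rw [one_div_mul_one_div]
        · simp
      rw [this]
      ring

/-! ### The local factor of a graph -/

open Classical in
/-- The local factor of `G`: the multilinear polynomial which on `0`-`1` vectors is the indicator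
of the vectors supported on an independent set. -/
noncomputable def localFactor {k : ℕ} (G : SimpleGraph (Fin k)) (x : Fin k → ℝ) : ℝ :=
  ∑ U ∈ Finset.univ.filter fun U : Finset (Fin k) => G.IsIndepSet U,
    (∏ i ∈ U, x i) * ∏ i ∈ Uᶜ, (1 - x i)

theorem localFactor_const {k : ℕ} (G : SimpleGraph (Fin k)) (q : ℝ) :
    localFactor G (fun _ => q) =
      ∑ m ∈ Finset.range (k + 1), (indepCount G m : ℝ) * (q ^ m * (1 - q) ^ (k - m)) := by
  classical
  rw [localFactor, ← Finset.sum_fiberwise_of_maps_to (t := Finset.range (k + 1))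
    (g := fun U : Finset (Fin k) => U.card)
    fun U _ => Finset.mem_range.2 (Nat.lt_succ_of_le (by simpa using U.card_le_univ))]
  refine Finset.sum_congr rfl fun m _ => ?_
  have hs : {s : Finset (Fin k) | G.IsNIndepSet m s} =
      ((Finset.univ.filter fun U : Finset (Fin k) => G.IsIndepSet U).filter
        fun U => U.card = m : Finset (Finset (Fin k))) := by
    ext s; simp [SimpleGraph.isNIndepSet_iff]
  rw [indepCount, hs, Set.ncard_coe_finset, ← nsmul_eq_mul]
  refine Finset.sum_eq_card_nsmul fun U hU => ?_
  rw [Finset.mem_filter] at hU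
  simp [Finset.card_compl, hU.2]

/-- Each `∏ (1 - x i)` over `Uᶜ` expands into signed monomials over `V ⊆ Uᶜ`. Existence of
coefficients suffices, because the value at `1/p` is computed by `localFactor_const`. -/
theorem exists_localFactor_eq_sum {k : ℕ} (G : SimpleGraph (Fin k)) :
    ∃ c : Finset (Fin k) → ℝ, ∀ x, localFactor G x = ∑ W, c W * ∏ i ∈ W, x i := by
  classical
  have h : localFactor G ∈ Submodule.span ℝ
      (Set.range fun (W : Finset (Fin k)) (x : Fin k → ℝ) => ∏ i ∈ W, x i) := by
    have h1 : localFactor G = ∑ U ∈ Finset.univ.filter fun U : Finset (Fin k) => G.IsIndepSet U,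
        ∑ V ∈ Uᶜ.powerset, ((-1 : ℝ) ^ V.card) • fun x : Fin k → ℝ => ∏ i ∈ U ∪ V, x i := by
      ext x
      simp only [localFactor, Finset.sum_apply, Pi.smul_apply, smul_eq_mul, sub_eq_add_neg,
        Finset.prod_one_add, Finset.mul_sum]
      refine Finset.sum_congr rfl fun U _ => Finset.sum_congr rfl fun V hV => ?_
      have hd : Disjoint U V :=
        Finset.disjoint_of_subset_right (Finset.mem_powerset.1 hV) disjoint_compl_right
      rw [Finset.prod_union hd, Finset.prod_neg]
      ring
    rw [h1]
    exact Submodule.sum_mem _ fun U _ => Submodule.sum_mem _ fun V _ =>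
      Submodule.smul_mem _ _ (Submodule.subset_span ⟨U ∪ V, rfl⟩)
  obtain ⟨c, hc⟩ := (Submodule.mem_span_range_iff_exists_fun ℝ).1 h
  refine ⟨c, fun x => ?_⟩
  rw [← hc]
  simp

-- Only the term `U = {i | p ∣ a i}` can survive at this `0`-`1` vector, and it occurs in the sum
-- exactly when that set is independent.
open Classical in
theorem localFactor_dvdInd {k : ℕ} (G : SimpleGraph (Fin k)) (p : ℕ) (a : Fin k → ℕ) :
    localFactor G (fun i => dvdInd p (a i)) =
      if ∃ i j, G.Adj i j ∧ p ∣ a i ∧ p ∣ a j then 0 else 1 := by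
  set S : Finset (Fin k) := {i | p ∣ a i} with hS
  have h1 (U : Finset (Fin k)) : (∏ i ∈ U, dvdInd p (a i)) * ∏ i ∈ Uᶜ, (1 - dvdInd p (a i)) =
      if U = S then 1 else 0 := by
    split_ifs with h
    · rw [h, Finset.prod_eq_one, Finset.prod_eq_one, one_mul]
      · intro i hi; simp_all [dvdInd]
      · intro i hi; simp_all [dvdInd]
    · obtain ⟨i, hi⟩ : ∃ i, ¬ (i ∈ U ↔ i ∈ S) := by
        by_contra! h'; exact h (Finset.ext h')
      by_cases hU : i ∈ U
      · rw [Finset.prod_eq_zero hU, zero_mul]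
        simp_all [dvdInd]
      · rw [mul_comm, Finset.prod_eq_zero (Finset.mem_compl.2 hU), zero_mul]
        simp_all [dvdInd]
  have h2 : G.IsIndepSet (S : Set (Fin k)) ↔ ¬ ∃ i j, G.Adj i j ∧ p ∣ a i ∧ p ∣ a j := by
    rw [SimpleGraph.isIndepSet_iff]
    constructor
    · rintro h ⟨i, j, hij, hi, hj⟩
      exact h (by simpa [hS] using hi) (by simpa [hS] using hj) hij.ne hij
    · intro h i hi j hj _ hij
      exact h ⟨i, j, hij, by simpa [hS] using hi, by simpa [hS] using hj⟩
  simp only [localFactor, h1]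
  rw [Finset.sum_ite_eq']
  simp only [Finset.mem_filter, Finset.mem_univ, true_and, h2]
  split_ifs <;> tauto

theorem gWiseCoprime_iff {k : ℕ} (G : SimpleGraph (Fin k)) (a : Fin k → ℕ) :
    GWiseCoprime G a ↔
      ∀ p : Nat.Primes, ¬ ∃ i j, G.Adj i j ∧ (p : ℕ) ∣ a i ∧ (p : ℕ) ∣ a j := by
  constructor
  · rintro h p ⟨i, j, hij, hi, hj⟩
    exact Nat.not_coprime_of_dvd_of_dvd p.2.one_lt hi hj (h i j hij)
  · intro h i j hij
    by_contra hc
    obtain ⟨p, hp, hi, hj⟩ := Nat.Prime.not_coprime_iff_dvd.1 hc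
    exact h ⟨p, hp⟩ ⟨i, j, hij, hi, hj⟩

/-! ### From finitely many primes to all primes -/

theorem summable_primes_one_div_sq :
    Summable fun p : Nat.Primes => 1 / ((p : ℕ) : ℝ) ^ 2 :=
  (Real.summable_one_div_nat_pow.2 one_lt_two).comp_injective Subtype.val_injective

/-- Sieving only by the primes in `T` costs at most the tail of `∑ 1 / p ^ 2`. -/
theorem abs_mean_prod_localFactor_sub_le {k : ℕ} (G : SimpleGraph (Fin k))
    (T : Finset Nat.Primes) {n : ℕ} (hn : 0 < n) :
    |(∑ a ∈ tupleBox k n, ∏ p ∈ T, localFactor G (fun i => dvdInd p (a i))) / (n : ℝ) ^ k -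
      (∑ a ∈ tupleBox k n, Set.indicator {a | GWiseCoprime G a} 1 a) / (n : ℝ) ^ k| ≤
      (k : ℝ) ^ 2 * ∑' p : {p // p ∉ T}, 1 / (((p : Nat.Primes) : ℕ) : ℝ) ^ 2 := by
  classical
  have hnk : (0 : ℝ) < (n : ℝ) ^ k := by positivity
  -- A prime dividing an entry of a tuple in the box is at most `n`, so finitely many primes outside
  -- `T` matter.
  set R : Finset {p // p ∉ T} :=
    (Set.Finite.toFinset (s := {p : {p // p ∉ T} | ((p : Nat.Primes) : ℕ) ≤ n})
      (Set.Finite.of_injOn (f := fun p : {p // p ∉ T} => ((p : Nat.Primes) : ℕ)) (t := Set.Iic n)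
        (fun p hp => hp) (fun p _ q _ h => Subtype.ext (Nat.Primes.coe_nat_injective h))
        (Set.finite_Iic n))) with hR
  -- The two indicators differ only if some prime outside `T` divides two entries joined by an edge.
  -- The union bound runs over all ordered pairs of indices, whence the factor `k ^ 2`.
  have hpt : ∀ a ∈ tupleBox k n,
      |(∏ p ∈ T, localFactor G (fun i => dvdInd p (a i))) -
        Set.indicator {a | GWiseCoprime G a} 1 a| ≤
      ∑ e : Fin k × Fin k, if e.1 ≠ e.2 then
        ∑ p ∈ R, dvdInd (p : Nat.Primes) (a e.1) * dvdInd (p : Nat.Primes) (a e.2) else 0 := by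
    intro a ha
    have hnn : ∀ e : Fin k × Fin k, 0 ≤ if e.1 ≠ e.2 then
        ∑ p ∈ R, dvdInd (p : Nat.Primes) (a e.1) * dvdInd (p : Nat.Primes) (a e.2) else 0 := by
      intro e
      split_ifs
      · exact Finset.sum_nonneg fun p _ => mul_nonneg (dvdInd_nonneg _ _) (dvdInd_nonneg _ _)
      · exact le_rfl
    simp only [localFactor_dvdInd]
    by_cases hT : ∃ p ∈ T, ∃ i j, G.Adj i j ∧ (p : ℕ) ∣ a i ∧ (p : ℕ) ∣ a j
    · obtain ⟨p, hp, h⟩ := hT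
      rw [Finset.prod_eq_zero hp (by exact if_pos h), Set.indicator_of_notMem, sub_zero, abs_zero]
      · exact Finset.sum_nonneg fun e _ => hnn e
      · exact fun h' => (gWiseCoprime_iff G a).1 h' p h
    · rw [Finset.prod_eq_one fun p hp => if_neg fun h => hT ⟨p, hp, h⟩]
      by_cases hG : GWiseCoprime G a
      · rw [Set.indicator_of_mem (by exact hG)]
        simpa using Finset.sum_nonneg fun e _ => hnn e
      · rw [Set.indicator_of_notMem (by exact hG), sub_zero, abs_one]
        rw [gWiseCoprime_iff] at hG
        push Not at hG
        obtain ⟨p, i, j, hij, hi, hj⟩ := hG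
        have hpT : p ∉ T := fun h => hT ⟨p, h, i, j, hij, hi, hj⟩
        have hai := mem_tupleBox.1 ha i
        have hpR : (⟨p, hpT⟩ : {p // p ∉ T}) ∈ R := by
          simpa [hR] using (Nat.le_of_dvd hai.1 hi).trans hai.2
        refine le_trans ?_ (Finset.single_le_sum (fun e _ => hnn e) (Finset.mem_univ (i, j)))
        rw [if_pos hij.ne]
        refine le_trans ?_ (Finset.single_le_sum
          (fun p _ => mul_nonneg (dvdInd_nonneg _ _) (dvdInd_nonneg _ _)) hpR)
        simp [dvdInd, hi, hj]
  rw [← sub_div, ← Finset.sum_sub_distrib, abs_div, abs_of_pos hnk, div_le_iff₀ hnk]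
  refine (Finset.abs_sum_le_sum_abs _ _).trans ((Finset.sum_le_sum hpt).trans ?_)
  rw [Finset.sum_comm]
  have hsum : Summable fun p : {p // p ∉ T} => 1 / (((p : Nat.Primes) : ℕ) : ℝ) ^ 2 :=
    summable_primes_one_div_sq.comp_injective Subtype.val_injective
  have hpair : ∀ e ∈ (Finset.univ : Finset (Fin k × Fin k)),
      (∑ a ∈ tupleBox k n, if e.1 ≠ e.2 then
        ∑ p ∈ R, dvdInd (p : Nat.Primes) (a e.1) * dvdInd (p : Nat.Primes) (a e.2) else 0) ≤
      (n : ℝ) ^ k * ∑' p : {p // p ∉ T}, 1 / (((p : Nat.Primes) : ℕ) : ℝ) ^ 2 := by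
    intro e _
    split_ifs with he
    · rw [Finset.sum_comm]
      refine (Finset.sum_le_sum fun p _ => sum_tupleBox_dvdInd_mul_dvdInd_le he _ n).trans ?_
      rw [← Finset.mul_sum]
      exact mul_le_mul_of_nonneg_left (hsum.sum_le_tsum R fun _ _ => by positivity) hnk.le
    · rw [Finset.sum_const_zero]
      positivity
  refine (Finset.sum_le_sum hpair).trans_eq ?_
  simp
  ring

/-- The probability of `G`-wise coprimality is the product over all primes of the local
probabilities. -/
theorem hasProbability_gWiseCoprime {k : ℕ} (G : SimpleGraph (Fin k)) {f : ℝ → ℝ} {x : ℝ}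
    (hf : ∀ q : ℝ, q ≠ 0 → f q =
      ∑ m ∈ Finset.range (k + 1), (indepCount G m : ℝ) * ((1 / q) ^ m * (1 - 1 / q) ^ (k - m)))
    (hx : HasEulerProduct f x) : HasProbability (GWiseCoprime G) x := by
  rw [← hasMean_indicator_iff]
  obtain ⟨c, hc⟩ := exists_localFactor_eq_sum G
  have hT (T : Finset Nat.Primes) :
      HasMean (fun a => ∏ p ∈ T, localFactor G (fun i => dvdInd p (a i)))
        (∏ p ∈ T, f ((p : ℕ) : ℝ)) := by
    have := hasMean_prod_multilinear c T (fun _ => 1) (by simp)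
    simp only [← hc, Nat.cast_one, div_one, Finset.prod_const_one, one_mul] at this
    convert this using 1
    · ext a; simp [dvdInd]
    · refine Finset.prod_congr rfl fun p _ => ?_
      rw [localFactor_const, hf _ (Nat.cast_ne_zero.2 p.2.ne_zero)]
  have htail : Tendsto (fun T : Finset Nat.Primes =>
      (k : ℝ) ^ 2 * ∑' p : {p // p ∉ T}, 1 / (((p : Nat.Primes) : ℕ) : ℝ) ^ 2) atTop (𝓝 0) := by
    have := (tendsto_tsum_compl_atTop_zero
      fun p : Nat.Primes => 1 / ((p : ℕ) : ℝ) ^ 2).const_mul ((k : ℝ) ^ 2)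
    rwa [mul_zero] at this
  -- `HasProd` is convergence along finite sets of primes, so one `T` can make both the sieve tail
  -- and the error of the partial product small; `n` is chosen afterwards.
  have hx' : Tendsto (fun T : Finset Nat.Primes => ∏ p ∈ T, f ((p : ℕ) : ℝ)) atTop (𝓝 x) := hx
  rw [HasMean, Metric.tendsto_atTop]
  intro ε hε
  obtain ⟨T, hT1, hT2⟩ := ((htail.eventually_lt_const (show (0 : ℝ) < ε / 3 by positivity)).and
    (Metric.tendsto_nhds.1 hx' (ε / 3) (by positivity))).exists
  obtain ⟨N, hN⟩ := Metric.tendsto_atTop.1 (hT T) (ε / 3) (by positivity)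
  refine ⟨max N 1, fun n hn => ?_⟩
  have h1 := hN n ((le_max_left _ _).trans hn)
  have h2 := (abs_mean_prod_localFactor_sub_le G T
    (lt_of_lt_of_le one_pos ((le_max_right _ _).trans hn))).trans_lt hT1
  rw [← Real.dist_eq, dist_comm] at h2
  linarith [dist_triangle4 ((∑ a ∈ tupleBox k n, Set.indicator {a | GWiseCoprime G a} 1 a) /
    (n : ℝ) ^ k) ((∑ a ∈ tupleBox k n, ∏ p ∈ T, localFactor G (fun i => dvdInd p (a i))) /
    (n : ℝ) ^ k) (∏ p ∈ T, f ((p : ℕ) : ℝ)) x]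

/-! ### Graphs as finite sets of edges, for enumeration -/

section EdgeSets

-- Quantifiers over the edges of a set should be decided by running through that set only.
attribute [-instance] Fintype.decidableForallFintype

/-- The edges of the complete graph on `k` vertices. -/
def allEdges (k : ℕ) : Finset (Sym2 (Fin k)) :=
  Finset.univ.filter fun e => ¬ e.IsDiag

/-- The number of sets of `m` vertices which contain no edge of `E`. -/
def edgeIndepCount {k : ℕ} (E : Finset (Sym2 (Fin k))) (m : ℕ) : ℕ :=
  ((Finset.univ.powersetCard m).filter fun s => ∀ e ∈ E, ∃ v, v ∈ e ∧ v ∉ s).card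

theorem edgeSet_fromEdgeSet_of_subset {k : ℕ} {E : Finset (Sym2 (Fin k))}
    (hE : E ⊆ allEdges k) : (SimpleGraph.fromEdgeSet (E : Set (Sym2 (Fin k)))).edgeSet = E := by
  rw [SimpleGraph.edgeSet_fromEdgeSet]
  ext e
  simp only [Set.mem_sdiff, Finset.mem_coe]
  exact ⟨fun h => h.1, fun h => ⟨h, (Finset.mem_filter.1 (hE h)).2⟩⟩

theorem exists_fromEdgeSet_eq {k : ℕ} (G : SimpleGraph (Fin k)) :
    ∃ E ∈ (allEdges k).powerset, SimpleGraph.fromEdgeSet (E : Set (Sym2 (Fin k))) = G := by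
  classical
  refine ⟨G.edgeFinset, Finset.mem_powerset.2 fun e he => ?_, ?_⟩
  · exact Finset.mem_filter.2 ⟨Finset.mem_univ _,
      G.not_isDiag_of_mem_edgeSet (SimpleGraph.mem_edgeFinset.1 he)⟩
  · rw [SimpleGraph.coe_edgeFinset, SimpleGraph.fromEdgeSet_edgeSet]

/-- Independence of `s` means that every edge has an endpoint outside `s`, a condition decidable
directly from `E`. -/
theorem indepCount_fromEdgeSet {k : ℕ} {E : Finset (Sym2 (Fin k))} (hE : E ⊆ allEdges k)
    (m : ℕ) : indepCount (SimpleGraph.fromEdgeSet (E : Set (Sym2 (Fin k)))) m =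
      edgeIndepCount E m := by
  rw [indepCount, edgeIndepCount, ← Set.ncard_coe_finset]
  congr 1
  ext s
  simp only [Set.mem_ofPred_eq, SimpleGraph.isNIndepSet_iff, SimpleGraph.isIndepSet_iff,
    Finset.coe_filter, Finset.mem_powersetCard, Finset.subset_univ, true_and]
  rw [and_comm]
  refine and_congr_right fun _ => ⟨fun h e he => ?_, fun h i hi j hj hij hadj => ?_⟩
  · have hdiag := (Finset.mem_filter.1 (hE he)).2
    induction e using Sym2.ind with
    | h i j =>
      by_contra! hc
      rw [Sym2.mk_isDiag_iff] at hdiag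
      exact h (hc i (Sym2.mem_mk_left i j)) (hc j (Sym2.mem_mk_right i j)) hdiag
        ((SimpleGraph.fromEdgeSet_adj _).2 ⟨he, hdiag⟩)
  · obtain ⟨v, hv, hvs⟩ := h s(i, j) ((SimpleGraph.fromEdgeSet_adj _).1 hadj).1
    rcases Sym2.mem_iff.1 hv with rfl | rfl
    · exact hvs hi
    · exact hvs hj

/-- The class `C` of graphs corresponds to the property `Q` of edge sets. -/
def IsEdgeClass {k : ℕ} (C : Set (SimpleGraph (Fin k))) (Q : Finset (Sym2 (Fin k)) → Prop) :
    Prop :=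
  ∀ E ∈ (allEdges k).powerset,
    SimpleGraph.fromEdgeSet (E : Set (Sym2 (Fin k))) ∈ C ↔ Q E

theorem isEdgeClass_graphsWithEdges (k i : ℕ) :
    IsEdgeClass (graphsWithEdges k i) fun E => E.card = i := by
  intro E hE
  rw [graphsWithEdges, Set.mem_ofPred_eq,
    edgeSet_fromEdgeSet_of_subset (Finset.mem_powerset.1 hE), Set.ncard_coe_finset]

theorem isEdgeClass_graphsTypeI (k i : ℕ) :
    IsEdgeClass (graphsTypeI k i) fun E => E.card = i ∧ ∃ v, ∀ e ∈ E, v ∈ e := by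
  intro E hE
  rw [graphsTypeI, Set.mem_ofPred_eq, isEdgeClass_graphsWithEdges k i E hE,
    edgeSet_fromEdgeSet_of_subset (Finset.mem_powerset.1 hE)]
  rfl

theorem isEdgeClass_graphsTypeII (k i : ℕ) :
    IsEdgeClass (graphsTypeII k i) fun E => E.card = i ∧ ¬ ∃ v, ∀ e ∈ E, v ∈ e := by
  intro E hE
  rw [graphsTypeII, Set.mem_ofPred_eq, isEdgeClass_graphsWithEdges k i E hE,
    edgeSet_fromEdgeSet_of_subset (Finset.mem_powerset.1 hE)]
  rfl

/-- Loopless edge sets correspond bijectively to graphs, so a class can be counted inside a finite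
powerset. -/
theorem IsEdgeClass.ncard_eq {k : ℕ} {C : Set (SimpleGraph (Fin k))}
    {Q : Finset (Sym2 (Fin k)) → Prop} [DecidablePred Q] (h : IsEdgeClass C Q) :
    C.ncard = ((allEdges k).powerset.filter Q).card := by
  have hC : C = (fun E : Finset (Sym2 (Fin k)) =>
      SimpleGraph.fromEdgeSet (E : Set (Sym2 (Fin k)))) ''
        ((allEdges k).powerset.filter Q : Finset _) := by
    ext G
    constructor
    · intro hG
      obtain ⟨E, hE, rfl⟩ := exists_fromEdgeSet_eq G
      exact ⟨E, Finset.mem_filter.2 ⟨hE, (h E hE).1 hG⟩, rfl⟩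
    · rintro ⟨E, hE, rfl⟩
      obtain ⟨hE, hQ⟩ := Finset.mem_filter.1 hE
      exact (h E hE).2 hQ
  rw [hC, Set.InjOn.ncard_image, Set.ncard_coe_finset]
  intro E hE E' hE' hEE
  have h1 := edgeSet_fromEdgeSet_of_subset (Finset.mem_powerset.1 (Finset.mem_filter.1 hE).1)
  have h2 := edgeSet_fromEdgeSet_of_subset (Finset.mem_powerset.1 (Finset.mem_filter.1 hE').1)
  rw [← Finset.coe_inj, ← h1, ← h2]
  exact congrArg _ hEE

theorem IsEdgeClass.tableRow {C : Set (SimpleGraph (Fin 4))}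
    {Q : Finset (Sym2 (Fin 4)) → Prop} [DecidablePred Q] (h : IsEdgeClass C Q) {N a b c : ℕ}
    (hN : ((allEdges 4).powerset.filter Q).card = N)
    (hQ : ∀ E ∈ (allEdges 4).powerset, Q E →
      edgeIndepCount E 2 = a ∧ edgeIndepCount E 3 = b ∧ edgeIndepCount E 4 = c) :
    TableRow C N a b c := by
  refine ⟨h.ncard_eq.trans hN, fun G hG => ?_⟩
  obtain ⟨E, hE, rfl⟩ := exists_fromEdgeSet_eq G
  simp only [indepCount_fromEdgeSet (Finset.mem_powerset.1 hE)]
  exact hQ E hE ((h E hE).1 hG)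

theorem indepCount_zero {k : ℕ} (G : SimpleGraph (Fin k)) : indepCount G 0 = 1 := by
  have : {s : Finset (Fin k) | G.IsNIndepSet 0 s} = {∅} := by
    ext s
    simp only [Set.mem_ofPred_eq, SimpleGraph.isNIndepSet_iff, Finset.card_eq_zero,
      Set.mem_singleton_iff]
    exact ⟨fun h => h.2, fun h => ⟨by simp [h], h⟩⟩
  rw [indepCount, this, Set.ncard_singleton]

theorem indepCount_one {k : ℕ} (G : SimpleGraph (Fin k)) : indepCount G 1 = k := by
  have : {s : Finset (Fin k) | G.IsNIndepSet 1 s} = Set.range fun i : Fin k => {i} := by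
    ext s
    simp only [Set.mem_ofPred_eq, SimpleGraph.isNIndepSet_iff, Finset.card_eq_one, Set.mem_range]
    constructor
    · rintro ⟨_, i, rfl⟩; exact ⟨i, rfl⟩
    · rintro ⟨i, rfl⟩; exact ⟨by simp, i, rfl⟩
  rw [indepCount, this, ← Set.image_univ,
    Set.ncard_image_of_injective _ Finset.singleton_injective, Set.ncard_univ, Nat.card_fin]

/-- Since `i_0 = 1` and `i_1 = 4` always, a row of the table determines the local factor. -/
theorem TableRow.hasGWiseProbability {C : Set (SimpleGraph (Fin 4))} {N a b c : ℕ}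
    (h : TableRow C N a b c) {f : ℝ → ℝ} {x : ℝ} (hx : HasEulerProduct f x)
    (hf : ∀ q : ℝ, f q = (1 - 1 / q) ^ 4 + 4 * (1 / q) * (1 - 1 / q) ^ 3 +
      a * (1 / q) ^ 2 * (1 - 1 / q) ^ 2 + b * (1 / q) ^ 3 * (1 - 1 / q) + c * (1 / q) ^ 4) :
    HasGWiseProbability C x := by
  intro G hG
  obtain ⟨h2, h3, h4⟩ := h.2 G hG
  refine hasProbability_gWiseCoprime G (fun q _ => ?_) hx
  rw [hf]
  simp only [Finset.sum_range_succ, Finset.sum_range_zero, indepCount_zero, indepCount_one,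
    h2, h3, h4]
  push_cast
  ring

theorem IsEdgeClass.hasGWiseProbability_three {C : Set (SimpleGraph (Fin 3))}
    {Q : Finset (Sym2 (Fin 3)) → Prop} (h : IsEdgeClass C Q) {a b : ℕ}
    (hQ : ∀ E ∈ (allEdges 3).powerset, Q E → edgeIndepCount E 2 = a ∧ edgeIndepCount E 3 = b)
    {f : ℝ → ℝ} {x : ℝ} (hx : HasEulerProduct f x)
    (hf : ∀ q : ℝ, f q = (1 - 1 / q) ^ 3 + 3 * (1 / q) * (1 - 1 / q) ^ 2 +
      a * (1 / q) ^ 2 * (1 - 1 / q) + b * (1 / q) ^ 3) :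
    HasGWiseProbability C x := by
  intro G hG
  obtain ⟨E, hE, rfl⟩ := exists_fromEdgeSet_eq G
  obtain ⟨h2, h3⟩ := hQ E hE ((h E hE).1 hG)
  rw [← indepCount_fromEdgeSet (Finset.mem_powerset.1 hE)] at h2 h3
  refine hasProbability_gWiseCoprime _ (fun q _ => ?_) hx
  rw [hf]
  simp only [Finset.sum_range_succ, Finset.sum_range_zero, indepCount_zero, indepCount_one,
    h2, h3]
  push_cast
  ring

/-! ### Convergence of the Euler products -/

theorem hasEulerProduct_one : HasEulerProduct (fun _ => 1) 1 := hasProd_one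

/-- With no term linear in `1 / q`, and `r` bounded on `[0, 1]`, the product converges by comparison
with `∑ 1 / p ^ 2`. -/
theorem exists_hasEulerProduct {f : ℝ → ℝ} (r : ℝ → ℝ) (hr : Continuous r)
    (hf : ∀ q : ℝ, f q = 1 + (1 / q) ^ 2 * r (1 / q)) : ∃ x, HasEulerProduct f x := by
  obtain ⟨C, hC⟩ := (isCompact_Icc (a := (0 : ℝ)) (b := 1)).exists_bound_of_continuousOn
    hr.continuousOn
  have hs : Summable fun p : Nat.Primes =>
      ‖(1 / ((p : ℕ) : ℝ)) ^ 2 * r (1 / ((p : ℕ) : ℝ))‖ := by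
    refine Summable.of_nonneg_of_le (fun _ => norm_nonneg _) (fun p => ?_)
      (summable_primes_one_div_sq.mul_right C)
    rw [norm_mul, norm_pow, Real.norm_of_nonneg (by positivity), one_div_pow]
    refine mul_le_mul_of_nonneg_left (hC _ ⟨by positivity, ?_⟩) (by positivity)
    exact div_le_one_of_le₀ (by exact_mod_cast p.2.one_lt.le) (by positivity)
  refine ⟨_, (multipliable_one_add_of_summable hs).hasProd.congr_fun ?_⟩
  intro p
  exact hf _

/-! ### Inclusion-exclusion -/

/-- Inclusion-exclusion over all graphs on `k` vertices. -/
theorem hasProbability_pairwiseNotCoprime {k : ℕ} (A : Finset (Sym2 (Fin k)) → ℝ)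
    (hA : ∀ E ∈ (allEdges k).powerset,
      HasProbability (GWiseCoprime (SimpleGraph.fromEdgeSet (E : Set (Sym2 (Fin k))))) (A E)) :
    HasProbability (k := k) PairwiseNotCoprime
      (∑ E ∈ (allEdges k).powerset, (-1) ^ E.card * A E) := by
  classical
  rw [← hasMean_indicator_iff]
  have key := HasMean.sum fun E hE =>
    (hasMean_indicator_iff.2 (hA E hE)).const_mul ((-1) ^ E.card)
  convert key using 1
  ext a
  -- Coprimality is symmetric, so it descends to unordered pairs.
  set c : Sym2 (Fin k) → Prop := fun e => ∀ i j, e = s(i, j) → Nat.Coprime (a i) (a j) with hc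
  have hc' (i j : Fin k) : c s(i, j) ↔ Nat.Coprime (a i) (a j) := by
    refine ⟨fun h => h i j rfl, fun h i' j' he => ?_⟩
    rcases Sym2.eq_iff.1 he with ⟨rfl, rfl⟩ | ⟨rfl, rfl⟩
    · exact h
    · exact h.symm
  have h1 (E : Finset (Sym2 (Fin k))) (hE : E ∈ (allEdges k).powerset) :
      Set.indicator {a | GWiseCoprime (SimpleGraph.fromEdgeSet (E : Set (Sym2 (Fin k)))) a}
        (1 : (Fin k → ℕ) → ℝ) a = ∏ e ∈ E, if c e then 1 else 0 := by
    rw [Finset.prod_ite_zero, Finset.prod_const_one, Set.indicator_apply]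
    congr 1
    rw [eq_iff_iff]
    simp only [Set.mem_ofPred_eq, GWiseCoprime, SimpleGraph.fromEdgeSet_adj]
    constructor
    · intro h e he
      have hdiag := (Finset.mem_filter.1 (Finset.mem_powerset.1 hE he)).2
      induction e using Sym2.ind with
      | h i j => exact (hc' i j).2 (h i j ⟨he, hdiag⟩)
    · exact fun h i j hij => (hc' i j).1 (h _ hij.1)
  have h2 : Set.indicator {a | PairwiseNotCoprime a} (1 : (Fin k → ℕ) → ℝ) a =
      ∏ e ∈ allEdges k, (1 + -(if c e then 1 else 0)) := by
    have h3 (e : Sym2 (Fin k)) :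
        (1 + -(if c e then (1 : ℝ) else 0)) = if ¬ c e then 1 else 0 := by
      split_ifs <;> simp_all
    simp only [h3]
    rw [Finset.prod_ite_zero, Finset.prod_const_one, Set.indicator_apply]
    congr 1
    rw [eq_iff_iff]
    simp only [Set.mem_ofPred_eq, PairwiseNotCoprime]
    constructor
    · intro h e he
      have hdiag := (Finset.mem_filter.1 he).2
      induction e using Sym2.ind with
      | h i j => exact fun hce => h i j hdiag ((hc' i j).1 hce)
    · exact fun h i j hij hco =>
        h s(i, j) (Finset.mem_filter.2 ⟨Finset.mem_univ _, hij⟩) ((hc' i j).2 hco)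
  rw [h2, Finset.prod_one_add]
  refine Finset.sum_congr rfl fun E hE => ?_
  rw [h1 E hE, Finset.prod_neg]

/-! ### The table for four vertices -/

theorem tableRow_zero : TableRow (graphsWithEdges 4 0) 1 6 4 1 :=
  (isEdgeClass_graphsWithEdges 4 0).tableRow (by decide +kernel) (by decide +kernel)

theorem tableRow_one : TableRow (graphsWithEdges 4 1) 6 5 2 0 :=
  (isEdgeClass_graphsWithEdges 4 1).tableRow (by decide +kernel) (by decide +kernel)

theorem tableRow_two_typeI : TableRow (graphsTypeI 4 2) 12 4 1 0 :=
  (isEdgeClass_graphsTypeI 4 2).tableRow (by decide +kernel) (by decide +kernel)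

theorem tableRow_two_typeII : TableRow (graphsTypeII 4 2) 3 4 0 0 :=
  (isEdgeClass_graphsTypeII 4 2).tableRow (by decide +kernel) (by decide +kernel)

theorem tableRow_three_typeI : TableRow (graphsTypeI 4 3) 4 3 1 0 :=
  (isEdgeClass_graphsTypeI 4 3).tableRow (by decide +kernel) (by decide +kernel)

theorem tableRow_three_typeII : TableRow (graphsTypeII 4 3) 16 3 0 0 :=
  (isEdgeClass_graphsTypeII 4 3).tableRow (by decide +kernel) (by decide +kernel)

theorem tableRow_four : TableRow (graphsWithEdges 4 4) 15 2 0 0 :=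
  (isEdgeClass_graphsWithEdges 4 4).tableRow (by decide +kernel) (by decide +kernel)

theorem tableRow_five : TableRow (graphsWithEdges 4 5) 6 1 0 0 :=
  (isEdgeClass_graphsWithEdges 4 5).tableRow (by decide +kernel) (by decide +kernel)

theorem tableRow_six : TableRow (graphsWithEdges 4 6) 1 0 0 0 :=
  (isEdgeClass_graphsWithEdges 4 6).tableRow (by decide +kernel) (by decide +kernel)

/-! ### Collecting the signed sum by classes of graphs -/

theorem hasProbability_pairwiseNotCoprime_three {x₀ x₁ x₂ x₃ : ℝ}
    (h₀ : HasGWiseProbability (graphsWithEdges 3 0) x₀)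
    (h₁ : HasGWiseProbability (graphsWithEdges 3 1) x₁)
    (h₂ : HasGWiseProbability (graphsWithEdges 3 2) x₂)
    (h₃ : HasGWiseProbability (graphsWithEdges 3 3) x₃) :
    HasProbability (k := 3) PairwiseNotCoprime (x₀ - 3 * x₁ + 3 * x₂ - x₃) := by
  have key := hasProbability_pairwiseNotCoprime (k := 3)
    (fun E => ![x₀, x₁, x₂, x₃] (Fin.ofNat 4 E.card)) fun E hE => by
      have hcard : E.card = 0 ∨ E.card = 1 ∨ E.card = 2 ∨ E.card = 3 := by
        revert E; decide +kernel
      have hmem (i : ℕ) := isEdgeClass_graphsWithEdges 3 i E hE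
      rcases hcard with h | h | h | h <;> simp only [h]
      · exact h₀ _ ((hmem 0).2 h)
      · exact h₁ _ ((hmem 1).2 h)
      · exact h₂ _ ((hmem 2).2 h)
      · exact h₃ _ ((hmem 3).2 h)
  convert key using 1
  -- The summand depends only on the number of edges, so the sum is regrouped along its fibres.
  have himage : (allEdges 3).powerset.image Finset.card = {0, 1, 2, 3} := by decide +kernel
  have hcount (i : ℕ) (hi : i ∈ ({0, 1, 2, 3} : Finset ℕ)) :
      ((allEdges 3).powerset.filter fun E => E.card = i).card = Nat.choose 3 i := by
    revert i; decide +kernel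
  rw [Finset.sum_comp (fun i => (-1) ^ i * ![x₀, x₁, x₂, x₃] (Fin.ofNat 4 i)) Finset.card, himage,
    Finset.sum_congr rfl fun i hi => by rw [hcount i hi]]
  simp [Nat.choose, Fin.ofNat]
  ring

theorem hasProbability_pairwiseNotCoprime_four {x₀ x₁ x₂₁ x₂₂ x₃₁ x₃₂ x₄ x₅ x₆ : ℝ}
    (h₀ : HasGWiseProbability (graphsWithEdges 4 0) x₀)
    (h₁ : HasGWiseProbability (graphsWithEdges 4 1) x₁)
    (h₂₁ : HasGWiseProbability (graphsTypeI 4 2) x₂₁)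
    (h₂₂ : HasGWiseProbability (graphsTypeII 4 2) x₂₂)
    (h₃₁ : HasGWiseProbability (graphsTypeI 4 3) x₃₁)
    (h₃₂ : HasGWiseProbability (graphsTypeII 4 3) x₃₂)
    (h₄ : HasGWiseProbability (graphsWithEdges 4 4) x₄)
    (h₅ : HasGWiseProbability (graphsWithEdges 4 5) x₅)
    (h₆ : HasGWiseProbability (graphsWithEdges 4 6) x₆) :
    HasProbability (k := 4) PairwiseNotCoprime
      (x₀ - 6 * x₁ + 12 * x₂₁ + 3 * x₂₂ - 4 * x₃₁ - 16 * x₃₂ + 15 * x₄ - 6 * x₅ + x₆) := by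
  set t : Finset (Sym2 (Fin 4)) → ℕ × Bool := fun E => (E.card, decide (∃ v, ∀ e ∈ E, v ∈ e)) with ht
  set A : ℕ × Bool → ℝ := fun y => match y with
    | (0, _) => x₀
    | (1, _) => x₁
    | (2, true) => x₂₁
    | (2, false) => x₂₂
    | (3, true) => x₃₁
    | (3, false) => x₃₂
    | (4, _) => x₄
    | (5, _) => x₅
    | (_, _) => x₆ with hA
  -- At most one edge always leaves a common vertex; four or more never do, since a vertex has
  -- degree at most `3`. Only two and three edges split into both types.
  set I : Finset (ℕ × Bool) := {(0, true), (1, true), (2, true), (2, false), (3, true), (3, false),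
    (4, false), (5, false), (6, false)} with hI
  have himage : (allEdges 4).powerset.image t = I := by decide +kernel
  have key := hasProbability_pairwiseNotCoprime (k := 4) (fun E => A (t E)) fun E hE => by
      have hE' : t E ∈ I := himage ▸ Finset.mem_image_of_mem t hE
      have hW (i : ℕ) := isEdgeClass_graphsWithEdges 4 i E hE
      have hT (i : ℕ) := isEdgeClass_graphsTypeI 4 i E hE
      have hT' (i : ℕ) := isEdgeClass_graphsTypeII 4 i E hE
      simp only [hI, Finset.mem_insert, Finset.mem_singleton] at hE'
      rcases hE' with h | h | h | h | h | h | h | h | h <;> rw [h] <;>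
        simp only [ht, Prod.mk.injEq, decide_eq_true_eq, decide_eq_false_iff_not] at h
      · exact h₀ _ ((hW 0).2 h.1)
      · exact h₁ _ ((hW 1).2 h.1)
      · exact h₂₁ _ ((hT 2).2 h)
      · exact h₂₂ _ ((hT' 2).2 h)
      · exact h₃₁ _ ((hT 3).2 h)
      · exact h₃₂ _ ((hT' 3).2 h)
      · exact h₄ _ ((hW 4).2 h.1)
      · exact h₅ _ ((hW 5).2 h.1)
      · exact h₆ _ ((hW 6).2 h.1)
  convert key using 1
  have hcount : ∀ y ∈ I, ((allEdges 4).powerset.filter fun E => t E = y).card =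
      match y with
      | (2, true) => 12
      | (2, false) => 3
      | (3, true) => 4
      | (3, false) => 16
      | (i, _) => Nat.choose 6 i := by decide +kernel
  rw [Finset.sum_comp (fun y : ℕ × Bool => (-1) ^ y.1 * A y) t, himage,
    Finset.sum_congr rfl fun y hy => by rw [hcount y hy]]
  simp [hI, hA, Nat.choose]
  ring


end EdgeSets

/-! ### Assembly -/

theorem mainTheorem4 :
    -- three integers
    (∃ A₃₁ A₃₂ A₃₃ : ℝ,
      HasGWiseProbability (graphsWithEdges 3 0) 1 ∧
      HasGWiseProbability (graphsWithEdges 3 1) A₃₁ ∧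
      HasGWiseProbability (graphsWithEdges 3 2) A₃₂ ∧
      HasGWiseProbability (graphsWithEdges 3 3) A₃₃ ∧
      HasEulerProduct (fun p => 1 - 1 / p ^ 2) A₃₁ ∧
      HasEulerProduct (fun p => (1 - 1 / p) * (1 + (1 - 1 / p) * (1 / p))) A₃₂ ∧
      HasEulerProduct (fun p => (1 - 1 / p) ^ 2 * (1 + 2 / p)) A₃₃ ∧
      HasProbability (k := 3) PairwiseNotCoprime (1 - 3 * A₃₁ + 3 * A₃₂ - A₃₃)) ∧
    -- the table of all graphs on four vertices
    (TableRow (graphsWithEdges 4 0) 1 6 4 1 ∧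
      TableRow (graphsWithEdges 4 1) 6 5 2 0 ∧
      TableRow (graphsTypeI 4 2) 12 4 1 0 ∧
      TableRow (graphsTypeII 4 2) 3 4 0 0 ∧
      TableRow (graphsTypeI 4 3) 4 3 1 0 ∧
      TableRow (graphsTypeII 4 3) 16 3 0 0 ∧
      TableRow (graphsWithEdges 4 4) 15 2 0 0 ∧
      TableRow (graphsWithEdges 4 5) 6 1 0 0 ∧
      TableRow (graphsWithEdges 4 6) 1 0 0 0) ∧
    -- four integers
    (∃ A₄₁ A₄₂₁ A₄₂₂ A₄₃₁ A₄₃₂ A₄₄ A₄₅ A₄₆ : ℝ,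
      HasGWiseProbability (graphsWithEdges 4 0) 1 ∧
      HasGWiseProbability (graphsWithEdges 4 1) A₄₁ ∧
      HasGWiseProbability (graphsTypeI 4 2) A₄₂₁ ∧
      HasGWiseProbability (graphsTypeII 4 2) A₄₂₂ ∧
      HasGWiseProbability (graphsTypeI 4 3) A₄₃₁ ∧
      HasGWiseProbability (graphsTypeII 4 3) A₄₃₂ ∧
      HasGWiseProbability (graphsWithEdges 4 4) A₄₄ ∧
      HasGWiseProbability (graphsWithEdges 4 5) A₄₅ ∧
      HasGWiseProbability (graphsWithEdges 4 6) A₄₆ ∧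
      HasEulerProduct (fun p => 1 - 1 / p ^ 2) A₄₁ ∧
      HasEulerProduct (fun p => (1 - 1 / p) * (1 + (1 - 1 / p) * (1 / p))) A₄₂₁ ∧
      HasEulerProduct (fun p => (1 - 1 / p ^ 2) ^ 2) A₄₂₂ ∧
      HasEulerProduct (fun p => (1 - 1 / p) * (1 + (1 - 1 / p) ^ 2 * (1 / p))) A₄₃₁ ∧
      HasEulerProduct (fun p => (1 - 1 / p) ^ 2 * (1 + 2 / p)) A₄₃₂ ∧
      HasEulerProduct (fun p => (1 - 1 / p) ^ 2 * (1 + 2 / p - 1 / p ^ 2)) A₄₄ ∧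
      HasEulerProduct (fun p => (1 - 1 / p) ^ 2 * (1 + 2 * (1 - 1 / p) * (1 / p))) A₄₅ ∧
      HasEulerProduct (fun p => (1 - 1 / p) ^ 3 * (1 + 3 / p)) A₄₆ ∧
      HasProbability (k := 4) PairwiseNotCoprime
        (1 - 6 * A₄₁ + 12 * A₄₂₁ + 3 * A₄₂₂ - 4 * A₄₃₁ - 16 * A₄₃₂ + 15 * A₄₄ - 6 * A₄₅
          + A₄₆)) := by
  -- In each case `r` is read off by expanding the local factor in `t = 1 / p` as `1 + t ^ 2 * r t`.
  obtain ⟨A₁, h₁⟩ := exists_hasEulerProduct (f := fun p => 1 - 1 / p ^ 2)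
    (fun _ => -1) (by fun_prop) fun q => by ring
  obtain ⟨A₂, h₂⟩ := exists_hasEulerProduct
    (f := fun p => (1 - 1 / p) * (1 + (1 - 1 / p) * (1 / p)))
    (fun t => -2 + t) (by fun_prop) fun q => by ring
  obtain ⟨A₃, h₃⟩ := exists_hasEulerProduct (f := fun p => (1 - 1 / p) ^ 2 * (1 + 2 / p))
    (fun t => -3 + 2 * t) (by fun_prop) fun q => by ring
  obtain ⟨A₂₂, h₂₂⟩ := exists_hasEulerProduct (f := fun p => (1 - 1 / p ^ 2) ^ 2)
    (fun t => -2 + t ^ 2) (by fun_prop) fun q => by ring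
  obtain ⟨A₃₁, h₃₁⟩ := exists_hasEulerProduct
    (f := fun p => (1 - 1 / p) * (1 + (1 - 1 / p) ^ 2 * (1 / p)))
    (fun t => -3 + 3 * t - t ^ 2) (by fun_prop) fun q => by ring
  obtain ⟨A₄, h₄⟩ := exists_hasEulerProduct
    (f := fun p => (1 - 1 / p) ^ 2 * (1 + 2 / p - 1 / p ^ 2))
    (fun t => -4 + 4 * t - t ^ 2) (by fun_prop) fun q => by ring
  obtain ⟨A₅, h₅⟩ := exists_hasEulerProduct
    (f := fun p => (1 - 1 / p) ^ 2 * (1 + 2 * (1 - 1 / p) * (1 / p)))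
    (fun t => -5 + 6 * t - 2 * t ^ 2) (by fun_prop) fun q => by ring
  obtain ⟨A₆, h₆⟩ := exists_hasEulerProduct (f := fun p => (1 - 1 / p) ^ 3 * (1 + 3 / p))
    (fun t => -6 + 8 * t - 3 * t ^ 2) (by fun_prop) fun q => by ring
  refine ⟨?_, ?_, ?_⟩
  · have g₀ := (isEdgeClass_graphsWithEdges 3 0).hasGWiseProbability_three (a := 3) (b := 1)
      (by decide +kernel) hasEulerProduct_one fun q => by push_cast; ring
    have g₁ := (isEdgeClass_graphsWithEdges 3 1).hasGWiseProbability_three (a := 2) (b := 0)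
      (by decide +kernel) h₁ fun q => by push_cast; ring
    have g₂ := (isEdgeClass_graphsWithEdges 3 2).hasGWiseProbability_three (a := 1) (b := 0)
      (by decide +kernel) h₂ fun q => by push_cast; ring
    have g₃ := (isEdgeClass_graphsWithEdges 3 3).hasGWiseProbability_three (a := 0) (b := 0)
      (by decide +kernel) h₃ fun q => by push_cast; ring
    exact ⟨A₁, A₂, A₃, g₀, g₁, g₂, g₃, h₁, h₂, h₃,
      hasProbability_pairwiseNotCoprime_three g₀ g₁ g₂ g₃⟩
  · exact ⟨tableRow_zero, tableRow_one, tableRow_two_typeI, tableRow_two_typeII,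
      tableRow_three_typeI, tableRow_three_typeII, tableRow_four, tableRow_five, tableRow_six⟩
  · have g₀ := tableRow_zero.hasGWiseProbability hasEulerProduct_one fun q => by push_cast; ring
    have g₁ := tableRow_one.hasGWiseProbability h₁ fun q => by push_cast; ring
    have g₂₁ := tableRow_two_typeI.hasGWiseProbability h₂ fun q => by push_cast; ring
    have g₂₂ := tableRow_two_typeII.hasGWiseProbability h₂₂ fun q => by push_cast; ring
    have g₃₁ := tableRow_three_typeI.hasGWiseProbability h₃₁ fun q => by push_cast; ring
    have g₃₂ := tableRow_three_typeII.hasGWiseProbability h₃ fun q => by push_cast; ring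
    have g₄ := tableRow_four.hasGWiseProbability h₄ fun q => by push_cast; ring
    have g₅ := tableRow_five.hasGWiseProbability h₅ fun q => by push_cast; ring
    have g₆ := tableRow_six.hasGWiseProbability h₆ fun q => by push_cast; ring
    -- `A₁`, `A₂` and `A₃` are the constants for three integers: the corresponding four-vertex
    -- classes have the same local factors.
    exact ⟨A₁, A₂, A₂₂, A₃₁, A₃, A₄, A₅, A₆, g₀, g₁, g₂₁, g₂₂, g₃₁, g₃₂, g₄, g₅, g₆,
      h₁, h₂, h₂₂, h₃₁, h₃, h₄, h₅, h₆,
      hasProbability_pairwiseNotCoprime_four g₀ g₁ g₂₁ g₂₂ g₃₁ g₃₂ g₄ g₅ g₆⟩
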